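/- Let $G$ be a finite Dedekind group, i.e. a finite group all of whose subgroups are normal, and let $R$ be a $G$-Tambara functor which is idle: for every subgroup $K \le G$ the Weyl group $\mathrm{Aut}_G(G/K)$ acts trivially on $R(G/K)$. Let $H \le G$ be a subgroup. A Green ideal of $R$ is a levelwise ideal closed under restrictions, transfers and conjugations; a Tambara ideal is a Green ideal $I$ that is also closed under norms (on all finite $G$-sets: $\mathrm{Nm}_f(I(X)) \subseteq \mathrm{Nm}_f(0) + I(Y)$ for every $f : X \to Y$). The product $I \cdot J$ is the Tambara ideal generated by the levelwise products $I(X) \cdot J(X)$. A prime ideal is a proper Tambara ideal $\mathfrak{p}$ such that, for all Tambara ideals $I, J$, $I \cdot J \subseteq \mathfrak{p}$ implies $I \subseteq \mathfrak{p}$ or $J \subseteq \mathfrak{p}$. The Nakaoka spectrum $\mathrm{Spec}(R)$ is the set of prime ideals with the topology whose generating closed sets are $V(I) = \{\mathfrak{p} \mid I \subseteq \mathfrak{p}\}$, $I$ a Tambara ideal. The restriction $\mathrm{Res}_H^G R$ is the $H$-Tambara functor $Y \mapsto R(G \times_H Y)$, and for a Green ideal $I$ of $R$ one puts $(\mathrm{Res}_H^G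 I)(Y) = I(G \times_H Y)$; the coinduction of an $H$-Tambara functor $S$ is $(\mathrm{CoInd}_H^G S)(X) = S(\mathrm{Res}^G_H X)$, and likewise for ideals. The $H$th stratum map $$ s_H : \mathrm{Spec}(\mathrm{Res}_H^G R) \to \mathrm{Spec}(R) $$ sends $\mathfrak{q}$ to the contraction of $\mathrm{CoInd}_H^G \mathfrak{q}$ along the adjunction unit $R \to \mathrm{CoInd}_H^G \mathrm{Res}_H^G R$. Then: 1. $I \mapsto \mathrm{Res}_H^G I$ is an order-preserving map from the Green ideals of $R$ to the Green ideals of $\mathrm{Res}_H^G R$; it sends Tambara ideals to Tambara ideals and prime ideals to prime ideals. 2. $\mathrm{Spec}(\mathrm{Res}_H^G R)$ is a retract of $\mathrm{Spec}(R)$ in the category of topological spaces: the maps $s_H : \mathrm{Spec}(\mathrm{Res}_H^G R) \to \mathrm{Spec}(R)$ and $\mathfrak{p} \mapsto \mathrm{Res}_H^G \mathfrak{p} : \mathrm{Spec}(R) \to \mathrm{Spec}(\mathrm{Res}_H^G R)$ are continuous, and $\mathrm{Res}_H^G(s_H(\mathfrak{q})) = \mathfrak{q}$ for all $\mathfrak{q}$.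 3. In particular the stratum map $s_H$ is injective. -/

import Mathlib

universe u v

/-! ## Finite `G`-sets -/

/-- A finite `G`-set. Morphisms of finite `G`-sets are equivariant maps `X →[G] Y`. -/
structure FinGSet (G : Type u) [Group G] : Type (u + 1) where
  carrier : Type u
  [action : MulAction G carrier]
  [finite : Finite carrier]

namespace FinGSet

instance (G : Type u) [Group G] : CoeSort (FinGSet G) (Type u) := ⟨FinGSet.carrier⟩

attribute [instance] FinGSet.action FinGSet.finite

/-- The commutative square with sides `g' : P → X`, `f' : P → Z`, `f : X → Y`, `g : Z → Y` is a
pullback square. For equivariant maps this says that it is a pullback square of `G`-sets. -/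
def IsPullbackSquare {P X Y Z : Type u} (g' : P → X) (f' : P → Z) (f : X → Y) (g : Z → Y) :
    Prop :=
  (∀ w, f (g' w) = g (f' w)) ∧ ∀ x z, f x = g z → ∃! w, g' w = x ∧ f' w = z

/-- The diagram `X ←p A ←e E →f' P →q Y` is an exponential diagram for `f : X → Y` and `p : A → X`:
`P` is the dependent product of `A` along `f`, i.e. a point of `P` over `y` is the same as a section
of `p` over the fibre of `f` at `y`; `E` is the fibre product of `X` and `P` over `Y`, and `e` is
evaluation of sections. -/
def IsExponentialDiagram {X Y A E P : Type u} (f : X → Y) (p : A → X) (e : E → A) (f' : E → P)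
    (q : P → Y) : Prop :=
  IsPullbackSquare (fun t => p (e t)) f' f q ∧
    ∀ (y : Y) (s : {x : X // f x = y} → A), (∀ x, p (s x) = x) →
      ∃! w : P, q w = y ∧ ∀ t : E, f' t = w → ∀ h : f (p (e t)) = y, e t = s ⟨p (e t), h⟩

end FinGSet

open FinGSet

/-! ## Tambara functors -/

/-- A `G`-Tambara functor, on all finite `G`-sets: restrictions, transfers and norms along
equivariant maps, turning disjoint unions into products, satisfying the base change formulas for
pullback squares and the distributive law for exponential diagrams. -/
structure TambaraFunctor (G : Type u) [Group G] : Type (max (u + 1) (v + 1)) where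
  obj : FinGSet G → Type v
  [commRing : ∀ X, CommRing (obj X)]
  res : ∀ {X Y : FinGSet G}, (X →[G] Y) → (obj Y →+* obj X)
  tr : ∀ {X Y : FinGSet G}, (X →[G] Y) → (obj X →+ obj Y)
  nm : ∀ {X Y : FinGSet G}, (X →[G] Y) → (obj X →* obj Y)
  res_id : ∀ {X : FinGSet G} (a : obj X), res (MulActionHom.id G) a = a
  tr_id : ∀ {X : FinGSet G} (a : obj X), tr (MulActionHom.id G) a = a
  nm_id : ∀ {X : FinGSet G} (a : obj X), nm (MulActionHom.id G) a = a
  res_comp : ∀ {X Y Z : FinGSet G} (g : Y →[G] Z) (f : X →[G] Y) (a : obj Z),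
    res (g.comp f) a = res f (res g a)
  tr_comp : ∀ {X Y Z : FinGSet G} (g : Y →[G] Z) (f : X →[G] Y) (a : obj X),
    tr (g.comp f) a = tr g (tr f a)
  nm_comp : ∀ {X Y Z : FinGSet G} (g : Y →[G] Z) (f : X →[G] Y) (a : obj X),
    nm (g.comp f) a = nm g (nm f a)
  subsingleton_of_isEmpty : ∀ X : FinGSet G, IsEmpty X → Subsingleton (obj X)
  bijective_res_of_coproduct : ∀ {X Y Z : FinGSet G} (i : X →[G] Z) (j : Y →[G] Z),
    Function.Bijective (Sum.elim i j) →
      Function.Bijective (fun a : obj Z => (res i a, res j a))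
  res_tr : ∀ {P X Y Z : FinGSet G} (g' : P →[G] X) (f' : P →[G] Z) (f : X →[G] Y) (g : Z →[G] Y),
    IsPullbackSquare g' f' f g → ∀ a : obj X, res g (tr f a) = tr f' (res g' a)
  res_nm : ∀ {P X Y Z : FinGSet G} (g' : P →[G] X) (f' : P →[G] Z) (f : X →[G] Y) (g : Z →[G] Y),
    IsPullbackSquare g' f' f g → ∀ a : obj X, res g (nm f a) = nm f' (res g' a)
  nm_tr : ∀ {X Y A E P : FinGSet G} (f : X →[G] Y) (p : A →[G] X) (e : E →[G] A) (f' : E →[G] P)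
    (q : P →[G] Y), IsExponentialDiagram f p e f' q →
      ∀ a : obj A, nm f (tr p a) = tr q (nm f' (res e a))

attribute [instance] TambaraFunctor.commRing

/-- A morphism of Tambara functors. -/
structure TambaraHom {G : Type u} [Group G] (R S : TambaraFunctor.{u, v} G) where
  app : ∀ X : FinGSet G, R.obj X →+* S.obj X
  app_res : ∀ {X Y : FinGSet G} (f : X →[G] Y) (a : R.obj Y),
    app X (R.res f a) = S.res f (app Y a)
  app_tr : ∀ {X Y : FinGSet G} (f : X →[G] Y) (a : R.obj X),
    app Y (R.tr f a) = S.tr f (app X a)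
  app_nm : ∀ {X Y : FinGSet G} (f : X →[G] Y) (a : R.obj X),
    app Y (R.nm f a) = S.nm f (app X a)

/-- `R` is idle: for every transitive finite `G`-set `X` (that is, `X ≅ G/K`), the group `Aut(X)`,
i.e. the Weyl group of `K`, acts trivially on `R(X)`. -/
def TambaraFunctor.IsIdle {G : Type u} [Group G] (R : TambaraFunctor.{u, v} G) : Prop :=
  ∀ X : FinGSet G, MulAction.IsPretransitive G X →
    ∀ φ : X →[G] X, Function.Bijective φ → ∀ a : R.obj X, R.res φ a = a

/-- A Dedekind group: all subgroups are normal. -/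
def IsDedekindGroup (G : Type u) [Group G] : Prop := ∀ K : Subgroup G, K.Normal

/-! ## Ideals and the Nakaoka spectrum -/

/-- A Green ideal: a levelwise ideal closed under restrictions and transfers (conjugations are
restrictions along isomorphisms). -/
structure GreenIdeal {G : Type u} [Group G] (R : TambaraFunctor.{u, v} G) where
  carrier : ∀ X : FinGSet G, Ideal (R.obj X)
  res_mem : ∀ {X Y : FinGSet G} (f : X →[G] Y) {a : R.obj Y}, a ∈ carrier Y →
    R.res f a ∈ carrier X
  tr_mem : ∀ {X Y : FinGSet G} (f : X →[G] Y) {a : R.obj X}, a ∈ carrier X →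
    R.tr f a ∈ carrier Y

namespace GreenIdeal

variable {G : Type u} [Group G] {R : TambaraFunctor.{u, v} G}

theorem carrier_injective :
    Function.Injective (GreenIdeal.carrier : GreenIdeal R → ∀ X : FinGSet G, Ideal (R.obj X)) := by
  rintro ⟨I, _, _⟩ ⟨J, _, _⟩ h
  cases h
  rfl

/-- Containment of ideals, level by level. -/
instance : PartialOrder (GreenIdeal R) := PartialOrder.lift GreenIdeal.carrier carrier_injective

/-- A Tambara ideal: a Green ideal `I` such that `Nm_f (I(X)) ⊆ Nm_f (0) + I(Y)` for all
`f : X → Y`. When `f` is surjective, for example when `X` and `Y` are transitive, `Nm_f (0) = 0`. -/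
def IsTambara (I : GreenIdeal R) : Prop :=
  ∀ ⦃X Y : FinGSet G⦄ (f : X →[G] Y) (a : R.obj X), a ∈ I.carrier X →
    R.nm f a - R.nm f 0 ∈ I.carrier Y

/-- The Tambara ideal generated by a set of elements in each level: the intersection of all Tambara
ideals that contain them. -/
def generate (s : ∀ X : FinGSet G, Set (R.obj X)) : GreenIdeal R where
  carrier X := sInf {A | ∃ I : GreenIdeal R, I.IsTambara ∧
    (∀ Y, s Y ⊆ (I.carrier Y : Set (R.obj Y))) ∧ A = I.carrier X}
  res_mem := by
    intro X Y f a ha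
    simp only [Submodule.mem_sInf] at ha ⊢
    rintro _ ⟨I, hI, hs, rfl⟩
    exact I.res_mem f (ha _ ⟨I, hI, hs, rfl⟩)
  tr_mem := by
    intro X Y f a ha
    simp only [Submodule.mem_sInf] at ha ⊢
    rintro _ ⟨I, hI, hs, rfl⟩
    exact I.tr_mem f (ha _ ⟨I, hI, hs, rfl⟩)

theorem generate_isTambara (s : ∀ X : FinGSet G, Set (R.obj X)) :
    (generate s : GreenIdeal R).IsTambara := by
  intro X Y f a ha
  simp only [generate, Submodule.mem_sInf] at ha ⊢
  rintro _ ⟨I, hI, hs, rfl⟩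
  exact hI f a (ha _ ⟨I, hI, hs, rfl⟩)

theorem generate_le {s : ∀ X : FinGSet G, Set (R.obj X)} {I : GreenIdeal R} (hI : I.IsTambara) :
    generate s ≤ I ↔ ∀ X, s X ⊆ (I.carrier X : Set (R.obj X)) := by
  constructor
  · intro h X a ha
    apply h X
    simp only [generate, Submodule.mem_sInf]
    rintro _ ⟨J, hJ, hs, rfl⟩
    exact hs X ha
  · intro h X
    exact sInf_le ⟨I, hI, h, rfl⟩

/-- The product of two ideals: the Tambara ideal generated by the products `a * b` of elements
`a ∈ I(X)`, `b ∈ J(X)`. -/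
instance : Mul (GreenIdeal R) :=
  ⟨fun I J => generate fun X => {c | ∃ a ∈ I.carrier X, ∃ b ∈ J.carrier X, a * b = c}⟩

theorem mul_le_iff {I J K : GreenIdeal R} (hK : K.IsTambara) :
    I * J ≤ K ↔ ∀ X, ∀ a ∈ I.carrier X, ∀ b ∈ J.carrier X, a * b ∈ K.carrier X := by
  refine (generate_le hK).trans (forall_congr' fun X => ?_)
  constructor
  · intro h a ha b hb
    exact h ⟨a, ha, b, hb, rfl⟩
  · rintro h _ ⟨a, ha, b, hb, rfl⟩
    exact h a ha b hb

/-- Prime (Tambara) ideals. As usual, a prime ideal is proper. -/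
structure IsPrime (p : GreenIdeal R) : Prop where
  isTambara : p.IsTambara
  ne_top : ∃ X, p.carrier X ≠ ⊤
  le_or_le : ∀ I J : GreenIdeal R, I.IsTambara → J.IsTambara → I * J ≤ p → I ≤ p ∨ J ≤ p

/-- The contraction of an ideal along a morphism of Tambara functors. -/
def comap {S : TambaraFunctor.{u, v} G} (φ : TambaraHom R S) (I : GreenIdeal S) :
    GreenIdeal R where
  carrier X := (I.carrier X).comap (φ.app X)
  res_mem := by
    intro X Y f a ha
    simp only [Ideal.mem_comap, φ.app_res] at ha ⊢
    exact I.res_mem f ha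
  tr_mem := by
    intro X Y f a ha
    simp only [Ideal.mem_comap, φ.app_tr] at ha ⊢
    exact I.tr_mem f ha

theorem IsTambara.comap {S : TambaraFunctor.{u, v} G} (φ : TambaraHom R S) {I : GreenIdeal S}
    (hI : I.IsTambara) : (I.comap φ).IsTambara := by
  intro X Y f a ha
  simp only [GreenIdeal.comap, Ideal.mem_comap, map_sub, φ.app_nm, map_zero] at ha ⊢
  exact hI f _ ha

end GreenIdeal

/-- The Nakaoka spectrum: the set of prime ideals. -/
def NakaokaSpec {G : Type u} [Group G] (R : TambaraFunctor.{u, v} G) : Type (max (u + 1) v) :=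
  {p : GreenIdeal R // p.IsPrime}

/-- The subset `V(I)` of prime ideals containing `I`. -/
def NakaokaSpec.V {G : Type u} [Group G] {R : TambaraFunctor.{u, v} G} (I : GreenIdeal R) :
    Set (NakaokaSpec R) :=
  {p | I ≤ p.1}

/-- The topology on the Nakaoka spectrum whose generating closed subsets are the `V(I)`, for all
Tambara ideals `I`. -/
instance {G : Type u} [Group G] (R : TambaraFunctor.{u, v} G) :
    TopologicalSpace (NakaokaSpec R) :=
  TopologicalSpace.generateFrom
    {U | ∃ I : GreenIdeal R, I.IsTambara ∧ U = (NakaokaSpec.V I)ᶜ}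

/-! ## Restriction and induction of finite `G`-sets -/

namespace FinGSet

variable {G : Type u} [Group G] (H : Subgroup G)

/-- A finite `G`-set regarded as an `H`-set. -/
def res (X : FinGSet G) : FinGSet H where
  carrier := X.carrier

/-- A `G`-map regarded as an `H`-map. -/
def resMap {X Y : FinGSet G} (f : X →[G] Y) : X.res H →[H] Y.res H where
  toFun := f
  map_smul' h x := f.map_smul (h : G) x

/-- The relation on `G × Y` identifying `(g h, y)` with `(g, h y)` for `h ∈ H`. -/
def indSetoid (Y : FinGSet H) : Setoid (G × Y) where
  r a b := ∃ h : H, a.1 = b.1 * h ∧ b.2 = h • a.2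
  iseqv :=
    { refl := fun a => ⟨1, by simp⟩
      symm := by
        rintro a b ⟨h, h1, h2⟩
        exact ⟨h⁻¹, by simp [h1], by simp [h2]⟩
      trans := by
        rintro a b c ⟨h, h1, h2⟩ ⟨k, k1, k2⟩
        exact ⟨k * h, by simp [h1, k1, mul_assoc], by simp [h2, k2, mul_smul]⟩ }

variable [Finite G]

/-- The induced `G`-set `G ×_H Y`. -/
def ind (Y : FinGSet H) : FinGSet G where
  carrier := Quotient (indSetoid H Y)
  action :=
    { smul := fun g => Quotient.map (fun a => (g * a.1, a.2)) (by
        rintro a b ⟨h, h1, h2⟩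
        exact ⟨h, by simp [h1, mul_assoc], h2⟩)
      one_smul := by
        rintro ⟨g, y⟩
        exact congrArg (Quotient.mk _) (Prod.ext (one_mul g) rfl)
      mul_smul := by
        rintro a b ⟨g, y⟩
        exact congrArg (Quotient.mk _) (Prod.ext (mul_assoc a b g) rfl) }

variable {H}

/-- The class `[g, y]` in `G ×_H Y`. -/
def indMk {Y : FinGSet H} (g : G) (y : Y) : ind H Y := Quotient.mk (indSetoid H Y) (g, y)

theorem indMk_surj {Y : FinGSet H} (z : ind H Y) : ∃ g y, z = indMk g y := by
  obtain ⟨⟨g, y⟩, rfl⟩ := Quotient.exists_rep z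
  exact ⟨g, y, rfl⟩

theorem indMk_eq {Y : FinGSet H} {g g' : G} {y y' : Y} :
    (indMk g y : ind H Y) = indMk g' y' ↔ ∃ h : H, g = g' * h ∧ y' = h • y :=
  Quotient.eq (r := indSetoid H Y)

theorem smul_indMk {Y : FinGSet H} (k g : G) (y : Y) :
    k • (indMk g y : ind H Y) = indMk (k * g) y := rfl

theorem indMk_inj {Y : FinGSet H} {g : G} {y y' : Y} :
    (indMk g y : ind H Y) = indMk g y' ↔ y = y' := by
  rw [indMk_eq]
  constructor
  · rintro ⟨h, h1, h2⟩
    have : h = 1 := by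
      apply Subtype.ext
      simpa using h1
    simp [h2, this]
  · rintro rfl
    exact ⟨1, by simp⟩

variable (H)

/-- The `G`-map `G ×_H f : G ×_H X → G ×_H Y`, `[g, x] ↦ [g, f x]`. -/
def indMap {X Y : FinGSet H} (f : X →[H] Y) : ind H X →[G] ind H Y where
  toFun := Quotient.map (fun a => (a.1, f a.2)) (by
    rintro a b ⟨h, h1, h2⟩
    exact ⟨h, h1, by simp [h2]⟩)
  map_smul' := by
    rintro k ⟨g, x⟩
    rfl

/-- The `G`-map `G ×_H X → X`, `[g, x] ↦ g x`. -/
def indCounit (X : FinGSet G) : ind H (X.res H) →[G] X where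
  toFun := Quotient.lift (fun a : G × X.carrier => a.1 • a.2) (by
    rintro ⟨g, (x : X.carrier)⟩ ⟨g', (x' : X.carrier)⟩ ⟨h, h1, h2⟩
    have h3 : g = g' * h := h1
    have h4 : x' = (h : G) • x := h2
    change g • x = g' • x'
    rw [h3, h4, mul_smul])
  map_smul' := by
    rintro k ⟨g, x⟩
    exact mul_smul (β := X.carrier) k g x

@[simp] theorem indMap_indMk {X Y : FinGSet H} (f : X →[H] Y) (g : G) (x : X) :
    indMap H f (indMk g x) = indMk g (f x) := rfl

@[simp] theorem indCounit_indMk (X : FinGSet G) (g : G) (x : X.carrier) :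
    indCounit H X (indMk (Y := X.res H) g x) = g • x := rfl

theorem indMap_id (X : FinGSet H) :
    indMap H (MulActionHom.id H : X →[H] X) = MulActionHom.id G := by
  ext z
  obtain ⟨g, x, rfl⟩ := indMk_surj z
  rfl

theorem indMap_comp {X Y Z : FinGSet H} (g : Y →[H] Z) (f : X →[H] Y) :
    indMap H (g.comp f) = (indMap H g).comp (indMap H f) := by
  ext z
  obtain ⟨g, x, rfl⟩ := indMk_surj z
  rfl

theorem exists_of_indMap_eq {X Y : FinGSet H} {f : X →[H] Y} {z : ind H X} {g : G} {y : Y}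
    (h : indMap H f z = indMk g y) : ∃ x, z = indMk g x ∧ f x = y := by
  obtain ⟨g', x, rfl⟩ := indMk_surj z
  rw [indMap_indMk, indMk_eq] at h
  obtain ⟨k, h1, h2⟩ := h
  exact ⟨k • x, indMk_eq.2 ⟨k, h1, rfl⟩, by simp [h2]⟩

theorem IsPullbackSquare.ind {P X Y Z : FinGSet H} {g' : P →[H] X} {f' : P →[H] Z} {f : X →[H] Y}
    {g : Z →[H] Y} (h : IsPullbackSquare g' f' f g) :
    IsPullbackSquare (indMap H g') (indMap H f') (indMap H f) (indMap H g) := by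
  constructor
  · intro w
    obtain ⟨k, w, rfl⟩ := indMk_surj w
    simp [h.1]
  · intro x z hxz
    obtain ⟨k, x, rfl⟩ := indMk_surj x
    rw [indMap_indMk] at hxz
    obtain ⟨z, rfl, hz⟩ := exists_of_indMap_eq H hxz.symm
    obtain ⟨w, ⟨hw1, hw2⟩, hw⟩ := h.2 x z hz.symm
    refine ⟨indMk k w, ⟨by simp [hw1], by simp [hw2]⟩, ?_⟩
    rintro w' ⟨h1, h2⟩
    obtain ⟨w', rfl, h3⟩ := exists_of_indMap_eq H h1
    rw [indMap_indMk, indMk_inj] at h2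
    rw [hw w' ⟨h3, h2⟩]

theorem IsExponentialDiagram.ind {X Y A E P : FinGSet H} {f : X →[H] Y} {p : A →[H] X}
    {e : E →[H] A} {f' : E →[H] P} {q : P →[H] Y} (h : IsExponentialDiagram f p e f' q) :
    IsExponentialDiagram (indMap H f) (indMap H p) (indMap H e) (indMap H f') (indMap H q) := by
  constructor
  · have h1 : IsPullbackSquare (p.comp e) f' f q := h.1
    have h2 := IsPullbackSquare.ind H h1
    rw [indMap_comp] at h2
    exact h2
  · intro y s hs
    obtain ⟨k, y, rfl⟩ := indMk_surj y
    have key : ∀ x : {x : X // f x = y},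
        ∃ a : A, s ⟨indMk k x.1, by simp [x.2]⟩ = indMk k a ∧ p a = x.1 :=
      fun x => exists_of_indMap_eq H (hs _)
    choose t ht1 ht2 using key
    obtain ⟨w, ⟨hw1, hw2⟩, hw⟩ := h.2 y t ht2
    refine ⟨indMk k w, ⟨by simp [hw1], ?_⟩, ?_⟩
    · intro c hc hc'
      obtain ⟨c, rfl, hc2⟩ := exists_of_indMap_eq H hc
      simp only [indMap_indMk, indMk_inj] at hc'
      have := hw2 c hc2 hc'
      simp only [indMap_indMk]
      rw [ht1 ⟨p (e c), hc'⟩, ← this]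
    · rintro w' ⟨h1, h2⟩
      obtain ⟨w', rfl, h3⟩ := exists_of_indMap_eq H h1
      rw [hw w' ⟨h3, ?_⟩]
      intro c hc hc'
      have := h2 (indMk k c) (by simp [hc]) (by simp [hc'])
      simp only [indMap_indMk] at this
      rw [ht1 ⟨p (e c), hc'⟩, indMk_inj] at this
      exact this

theorem bijective_sumElim_indMap {X Y Z : FinGSet H} {i : X →[H] Z} {j : Y →[H] Z}
    (h : Function.Bijective (Sum.elim i j)) :
    Function.Bijective (Sum.elim (indMap H i) (indMap H j)) := by
  constructor
  · have aux : ∀ a b : X ⊕ Y, Sum.elim i j a = Sum.elim i j b → a = b := fun a b => @h.1 a b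
    rintro (a | a) (b | b) hab <;> obtain ⟨k, b, rfl⟩ := indMk_surj b <;>
      simp only [Sum.elim_inl, Sum.elim_inr, indMap_indMk] at hab <;>
      obtain ⟨a, rfl, ha⟩ := exists_of_indMap_eq H hab
    · cases aux (Sum.inl a) (Sum.inl b) ha
      rfl
    · cases aux (Sum.inl a) (Sum.inr b) ha
    · cases aux (Sum.inr a) (Sum.inl b) ha
    · cases aux (Sum.inr a) (Sum.inr b) ha
      rfl
  · intro z
    obtain ⟨k, z, rfl⟩ := indMk_surj z
    obtain ⟨x | y, hx⟩ := h.2 z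
    · exact ⟨Sum.inl (indMk k x), by simpa [indMk_inj] using hx⟩
    · exact ⟨Sum.inr (indMk k y), by simpa [indMk_inj] using hx⟩

theorem isPullbackSquare_indCounit {X Y : FinGSet G} (f : X →[G] Y) :
    IsPullbackSquare (indCounit H X) (indMap H (resMap H f)) f (indCounit H Y) := by
  constructor
  · intro w
    obtain ⟨k, w, rfl⟩ := indMk_surj w
    exact f.map_smul k w
  · intro x z hxz
    obtain ⟨k, y, rfl⟩ := indMk_surj z
    replace hxz : f x = k • (show Y from y) := hxz
    have hy : f (k⁻¹ • x) = y := by rw [map_smul, hxz, inv_smul_smul]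
    refine ⟨indMk (Y := X.res H) k (k⁻¹ • x : X), ⟨smul_inv_smul k x, ?_⟩, ?_⟩
    · exact congrArg (indMk (Y := Y.res H) k) hy
    · rintro w ⟨h1, h2⟩
      obtain ⟨w, rfl, hw⟩ := exists_of_indMap_eq H h2
      replace h1 : k • (show X from w) = x := h1
      refine indMk_inj.2 ?_
      rw [← h1, inv_smul_smul]

end FinGSet

/-! ## Restriction and coinduction of Tambara functors -/

namespace TambaraFunctor

variable {G : Type u} [Group G] (H : Subgroup G)

/-- The restriction `Res_H^G R` of a `G`-Tambara functor, `(Res_H^G R)(Y) = R(G ×_H Y)`. In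
particular `(Res_H^G R)(H/L) = R(G/L)`. -/
def restrict [Finite G] (R : TambaraFunctor.{u, v} G) : TambaraFunctor.{u, v} H where
  obj Y := R.obj (ind H Y)
  res f := R.res (indMap H f)
  tr f := R.tr (indMap H f)
  nm f := R.nm (indMap H f)
  res_id a := by rw [indMap_id, R.res_id]
  tr_id a := by rw [indMap_id, R.tr_id]
  nm_id a := by rw [indMap_id, R.nm_id]
  res_comp g f a := by rw [indMap_comp, R.res_comp]
  tr_comp g f a := by rw [indMap_comp, R.tr_comp]
  nm_comp g f a := by rw [indMap_comp, R.nm_comp]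
  subsingleton_of_isEmpty X hX := R.subsingleton_of_isEmpty _ ⟨fun z => by
    obtain ⟨_, x, _⟩ := indMk_surj z
    exact hX.false x⟩
  bijective_res_of_coproduct i j h :=
    R.bijective_res_of_coproduct _ _ (bijective_sumElim_indMap H h)
  res_tr g' f' f g h := R.res_tr _ _ _ _ (IsPullbackSquare.ind H h)
  res_nm g' f' f g h := R.res_nm _ _ _ _ (IsPullbackSquare.ind H h)
  nm_tr f p e f' q h := R.nm_tr _ _ _ _ _ (IsExponentialDiagram.ind H h)

/-- The coinduction `CoInd_H^G S` of an `H`-Tambara functor, `(CoInd_H^G S)(X) = S(Res_H^G X)`. -/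
def coinduce {H : Subgroup G} (S : TambaraFunctor.{u, v} H) : TambaraFunctor.{u, v} G where
  obj X := S.obj (X.res H)
  res f := S.res (resMap H f)
  tr f := S.tr (resMap H f)
  nm f := S.nm (resMap H f)
  res_id a := S.res_id a
  tr_id a := S.tr_id a
  nm_id a := S.nm_id a
  res_comp g f a := S.res_comp (resMap H g) (resMap H f) a
  tr_comp g f a := S.tr_comp (resMap H g) (resMap H f) a
  nm_comp g f a := S.nm_comp (resMap H g) (resMap H f) a
  subsingleton_of_isEmpty X hX := S.subsingleton_of_isEmpty (X.res H) hX
  bijective_res_of_coproduct i j h := S.bijective_res_of_coproduct (resMap H i) (resMap H j) h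
  res_tr g' f' f g h := S.res_tr (resMap H g') (resMap H f') (resMap H f) (resMap H g) h
  res_nm g' f' f g h := S.res_nm (resMap H g') (resMap H f') (resMap H f) (resMap H g) h
  nm_tr f p e f' q h :=
    S.nm_tr (resMap H f) (resMap H p) (resMap H e) (resMap H f') (resMap H q) h

/-- The unit `R → CoInd_H^G Res_H^G R` of the adjunction between restriction and coinduction. At
level `X` it is the restriction `R(X) → R(G ×_H X)` along the action map. -/
def coindUnit [Finite G] (R : TambaraFunctor.{u, v} G) :
    TambaraHom R (coinduce (R.restrict H)) where
  app X := R.res (indCounit H X)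
  app_res {X Y} f a := by
    have h : f.comp (indCounit H X) = (indCounit H Y).comp (indMap H (resMap H f)) :=
      MulActionHom.ext (isPullbackSquare_indCounit H f).1
    change R.res (indCounit H X) (R.res f a) =
      R.res (indMap H (resMap H f)) (R.res (indCounit H Y) a)
    rw [← R.res_comp, ← R.res_comp, h]
  app_tr f a := R.res_tr _ _ _ _ (isPullbackSquare_indCounit H f) a
  app_nm f a := R.res_nm _ _ _ _ (isPullbackSquare_indCounit H f) a

end TambaraFunctor

/-! ## Restriction and coinduction of ideals, and the strata -/

namespace GreenIdeal

variable {G : Type u} [Group G] (H : Subgroup G)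

/-- The restriction `Res_H^G I` of an ideal, `(Res_H^G I)(Y) = I(G ×_H Y)`. In particular
`(Res_H^G I)(H/L) = I(G/L)`. -/
def restrict [Finite G] {R : TambaraFunctor.{u, v} G} (I : GreenIdeal R) :
    GreenIdeal (R.restrict H) where
  carrier Y := I.carrier (ind H Y)
  res_mem f _ ha := I.res_mem (indMap H f) ha
  tr_mem f _ ha := I.tr_mem (indMap H f) ha

/-- The coinduction `CoInd_H^G I` of an ideal, `(CoInd_H^G I)(X) = I(Res_H^G X)`. -/
def coinduce {H : Subgroup G} {S : TambaraFunctor.{u, v} H} (I : GreenIdeal S) :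
    GreenIdeal S.coinduce where
  carrier X := I.carrier (X.res H)
  res_mem f _ ha := I.res_mem (resMap H f) ha
  tr_mem f _ ha := I.tr_mem (resMap H f) ha

theorem IsTambara.restrictIdeal [Finite G] {R : TambaraFunctor.{u, v} G} {I : GreenIdeal R}
    (hI : I.IsTambara) : (I.restrict H).IsTambara :=
  fun _ _ f a ha => hI (indMap H f) a ha

theorem IsTambara.coinduce {H : Subgroup G} {S : TambaraFunctor.{u, v} H} {I : GreenIdeal S}
    (hI : I.IsTambara) : I.coinduce.IsTambara :=
  fun _ _ f a ha => hI (resMap H f) a ha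

end GreenIdeal

namespace NakaokaSpec

variable {G : Type u} [Group G] [Finite G] (H : Subgroup G) (R : TambaraFunctor.{u, v} G)

/-- The `H`-map `Y → G ×_H Y`, `y ↦ [1, y]`. -/
def indInclusion (Y : FinGSet H) : Y →[H] (ind H Y).res H where
  toFun y := indMk 1 y
  map_smul' h y := by
    change indMk 1 (h • y) = indMk ((h : G) * 1) y
    exact (indMk_eq.2 ⟨h, by simp, rfl⟩).symm

theorem isPrime_contract {q : GreenIdeal (R.restrict H)} (hq : q.IsPrime) :
    (q.coinduce.comap (R.coindUnit H)).IsPrime where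
  isTambara := hq.isTambara.coinduce.comap _
  ne_top := by
    obtain ⟨Y, hY⟩ := hq.ne_top
    refine ⟨ind H Y, fun h => hY ?_⟩
    rw [Ideal.eq_top_iff_one] at h ⊢
    have h1 : (1 : (R.restrict H).obj ((ind H Y).res H)) ∈ q.carrier ((ind H Y).res H) := by
      have h2 : (R.coindUnit H).app (ind H Y) 1 ∈ q.carrier ((ind H Y).res H) := h
      rw [map_one] at h2
      exact h2
    have h3 := q.res_mem (indInclusion H Y) h1
    rwa [map_one] at h3
  le_or_le := by
    intro I J hI hJ hIJ
    rw [GreenIdeal.mul_le_iff (hq.isTambara.coinduce.comap _)] at hIJ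
    have key : I.restrict H * J.restrict H ≤ q := by
      rw [GreenIdeal.mul_le_iff hq.isTambara]
      intro Y a ha b hb
      have h1 := q.res_mem (indInclusion H Y) (hIJ (ind H Y) a ha b hb)
      have h2 : (indCounit H (ind H Y)).comp (indMap H (indInclusion H Y)) =
          MulActionHom.id G := by
        ext z
        obtain ⟨g, y, rfl⟩ := indMk_surj z
        change g • (indMk 1 y : ind H Y) = indMk g y
        rw [smul_indMk, mul_one]
      have h3 : (R.restrict H).res (indInclusion H Y)
          (R.res (indCounit H (ind H Y)) (a * b)) = a * b := by
        refine (R.res_comp _ _ _).symm.trans ?_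
        rw [h2]
        exact R.res_id _
      have h4 : (R.restrict H).res (indInclusion H Y)
          (R.res (indCounit H (ind H Y)) (a * b)) ∈ q.carrier Y := h1
      rw [h3] at h4
      exact h4
    refine (hq.le_or_le _ _ (hI.restrictIdeal H) (hJ.restrictIdeal H) key).imp ?_ ?_ <;>
    · intro h X a ha
      exact h (X.res H) (GreenIdeal.res_mem _ (indCounit H X) ha)

/-- The map `Spec(Res_H^G R) ≅ Spec(CoInd_H^G Res_H^G R) → Spec(R)` whose image is the `H`th stratum
of `Spec(R)`: a prime ideal `q` is sent to the contraction of `CoInd_H^G q` along the adjunction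
unit `R → CoInd_H^G Res_H^G R`. -/
def stratumMap (q : NakaokaSpec (R.restrict H)) : NakaokaSpec R :=
  ⟨q.1.coinduce.comap (R.coindUnit H), isPrime_contract H R q.2⟩

end NakaokaSpec

/-! Write `S = Res_H^G R`. Contraction along the unit is right adjoint to the restriction of ideals,
and `Res_H^G` of the contraction of `J` is `J` itself once restriction along any `G`-map
`G ×_H T → G ×_H Y`, `T` transitive, agrees with restriction along an induced map. Idleness gives
this when the subgroups of `H` are normal: any `G`-map `G ×_H T → G ×_H Y` is then an induced map
precomposed with an automorphism of `G ×_H T`.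

For primality of `Res_H^G p` one needs Tambara ideals of `R` that play the role of ideals of `S`.
Let `J.extend` consist of the transfers of multiples of norms of elements of the contraction of `J`
on `G`-sets over `G/H`. When `H` is normal, such a norm into a transitive `Z` is a multiple of a
norm along `G ×_H Hz → Z` of an element of `J(Hz)`. Hence a product of two such norms is a multiple
of the norm of a product `a * b` with `a ∈ I(Hz)` and `b ∈ J(Hz)`, so that `I.extend * J.extend ≤ p`
as soon as `I * J ≤ Res_H^G p`. Moreover `J.extend ≤ p ↔ J ≤ Res_H^G p`, which also gives the
continuity of `p ↦ Res_H^G p`. -/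

/-! ## Finite limits, colimits and dependent products of finite `G`-sets -/

namespace FinGSet

variable {G : Type u} [Group G]

/-- The empty `G`-set, the initial object. -/
def empty (G : Type u) [Group G] : FinGSet G where
  carrier := PEmpty
  action := { smul := fun _ x => x, one_smul := fun x => x.elim, mul_smul := fun _ _ x => x.elim }

instance : IsEmpty (empty G) := inferInstanceAs (IsEmpty PEmpty)

/-- The unique map out of an empty `G`-set. -/
def ofIsEmpty (E : FinGSet G) [IsEmpty E] (X : FinGSet G) : E →[G] X where
  toFun x := isEmptyElim x
  map_smul' _ x := isEmptyElim x

/-- The one-point `G`-set, the terminal object. -/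
def point (G : Type u) [Group G] : FinGSet G where
  carrier := PUnit

/-- The unique map to the one-point `G`-set. -/
def toPoint (X : FinGSet G) : X →[G] point G where
  toFun _ := PUnit.unit
  map_smul' _ _ := rfl

/-- The disjoint union of two finite `G`-sets. -/
def sum (X Y : FinGSet G) : FinGSet G where
  carrier := X.carrier ⊕ Y.carrier

/-- The left inclusion into a disjoint union. -/
def inl (X Y : FinGSet G) : X →[G] sum X Y where
  toFun := Sum.inl
  map_smul' _ _ := rfl

/-- The right inclusion into a disjoint union. -/
def inr (X Y : FinGSet G) : Y →[G] sum X Y where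
  toFun := Sum.inr
  map_smul' _ _ := rfl

/-- The map out of a disjoint union given by maps on the summands. -/
def desc {X Y Z : FinGSet G} (f : X →[G] Z) (g : Y →[G] Z) : sum X Y →[G] Z where
  toFun := Sum.elim f g
  map_smul' := by
    rintro k (x | y)
    · exact f.map_smul k x
    · exact g.map_smul k y

theorem desc_comp_inl {X Y Z : FinGSet G} (f : X →[G] Z) (g : Y →[G] Z) :
    (desc f g).comp (inl X Y) = f := rfl

theorem desc_comp_inr {X Y Z : FinGSet G} (f : X →[G] Z) (g : Y →[G] Z) :
    (desc f g).comp (inr X Y) = g := rfl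

/-- The disjoint union of two maps. -/
def sumMap {X Y X' Y' : FinGSet G} (f : X →[G] X') (g : Y →[G] Y') : sum X Y →[G] sum X' Y' :=
  desc ((inl X' Y').comp f) ((inr X' Y').comp g)

theorem bijective_elim_inl_inr (X Y : FinGSet G) :
    Function.Bijective (Sum.elim (inl X Y) (inr X Y)) :=
  (Sum.elim_inl_inr : Sum.elim Sum.inl Sum.inr = (id : X ⊕ Y → X ⊕ Y)) ▸ Function.bijective_id

theorem isPullbackSquare_inl {X Y X' Y' : FinGSet G} (f : X →[G] X') (g : Y →[G] Y') :
    IsPullbackSquare (inl X Y) f (sumMap f g) (inl X' Y') := by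
  refine ⟨fun _ => rfl, ?_⟩
  rintro (x | y) z h
  · exact ⟨x, ⟨rfl, Sum.inl_injective h⟩, fun w hw => Sum.inl_injective hw.1⟩
  · exact absurd h Sum.inr_ne_inl

theorem isPullbackSquare_inr {X Y X' Y' : FinGSet G} (f : X →[G] X') (g : Y →[G] Y') :
    IsPullbackSquare (inr X Y) g (sumMap f g) (inr X' Y') := by
  refine ⟨fun _ => rfl, ?_⟩
  rintro (x | y) z h
  · exact absurd h Sum.inl_ne_inr
  · exact ⟨y, ⟨rfl, Sum.inr_injective h⟩, fun w hw => Sum.inr_injective hw.1⟩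

theorem isPullbackSquare_of_injective {X Y : FinGSet G} {i : X →[G] Y}
    (hi : Function.Injective i) :
    IsPullbackSquare (MulActionHom.id G : X →[G] X) (MulActionHom.id G : X →[G] X) i i :=
  ⟨fun _ => rfl, fun x _ h => ⟨x, ⟨rfl, hi h⟩, fun _ hw => hw.1⟩⟩

theorem isPullbackSquare_of_disjoint {X Y Z : FinGSet G} {f : X →[G] Y} {g : Z →[G] Y}
    (h : ∀ x z, f x ≠ g z) :
    IsPullbackSquare (ofIsEmpty (empty G) X) (ofIsEmpty (empty G) Z) f g :=
  ⟨fun w => isEmptyElim w, fun x z hxz => absurd hxz (h x z)⟩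

theorem IsPullbackSquare.surjective {P X Y Z : Type u} {g' : P → X} {f' : P → Z} {f : X → Y}
    {g : Z → Y} (h : IsPullbackSquare g' f' f g) (hf : Function.Surjective f) :
    Function.Surjective f' := fun z => by
  obtain ⟨x, hx⟩ := hf (g z)
  obtain ⟨w, hw, _⟩ := h.2 x z hx
  exact ⟨w, hw.2⟩

theorem exists_isPullbackSquare {X Y Z : FinGSet G} (f : X →[G] Y) (g : Z →[G] Y) :
    ∃ (P : FinGSet G) (g' : P →[G] X) (f' : P →[G] Z), IsPullbackSquare g' f' f g := by
  let S : SubMulAction G (X.carrier × Z.carrier) :=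
    { carrier := {a | f a.1 = g a.2}
      smul_mem' := fun k a (ha : f a.1 = g a.2) =>
        show f (k • a.1) = g (k • a.2) by rw [map_smul, map_smul, ha] }
  refine ⟨⟨S⟩, ⟨fun a => a.1.1, fun _ _ => rfl⟩, ⟨fun a => a.1.2, fun _ _ => rfl⟩,
    fun a => a.2, fun x z h => ⟨⟨(x, z), h⟩, ⟨rfl, rfl⟩, ?_⟩⟩
  rintro ⟨⟨x', z'⟩, h'⟩ ⟨rfl, rfl⟩
  rfl

theorem bijOn_range_section {X Y A : Type u} {f : X → Y} {p : A → X} {y : Y}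
    {s : {x : X // f x = y} → A} (hs : ∀ x, p (s x) = x) :
    Set.BijOn p (Set.range s) (f ⁻¹' {y}) := by
  refine ⟨?_, ?_, fun x hx => ⟨s ⟨x, hx⟩, ⟨_, rfl⟩, hs _⟩⟩
  · rintro _ ⟨x, rfl⟩
    exact (congrArg f (hs x)).trans x.2
  · rintro _ ⟨x, rfl⟩ _ ⟨x', rfl⟩ h
    rw [hs, hs] at h
    rw [Subtype.ext h]

theorem eq_range_section {X Y A : Type u} {f : X → Y} {p : A → X} {y : Y}
    {s : {x : X // f x = y} → A} {r : Set A} (hr : Set.BijOn p r (f ⁻¹' {y}))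
    (h : ∀ a (ha : a ∈ r), a = s ⟨p a, hr.mapsTo ha⟩) : r = Set.range s := by
  refine Set.Subset.antisymm (fun a ha => ⟨_, (h a ha).symm⟩) ?_
  rintro _ ⟨⟨_, hx⟩, rfl⟩
  obtain ⟨a, ha, rfl⟩ := hr.surjOn hx
  exact h a ha ▸ ha

open scoped Pointwise in
/-- The dependent product of `p : A → X` along `f : X → Y`, as a set of pairs: a section of `p` over
the fibre of `f` at `y` is encoded by its image `s ⊆ A`, which `p` maps bijectively to the fibre. -/
def sections {X Y A : FinGSet G} (f : X →[G] Y) (p : A →[G] X) :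
    SubMulAction G (Y.carrier × Set A.carrier) where
  carrier := {w | Set.BijOn p w.2 (f ⁻¹' {w.1})}
  smul_mem' := by
    rintro k ⟨y, s⟩ ⟨hmaps, hinj, hsurj⟩
    refine ⟨?_, ?_, ?_⟩
    · rintro _ ⟨a, ha, rfl⟩
      have hfa : f (p a) = y := hmaps ha
      change f (p (k • a)) = k • y
      rw [map_smul, map_smul, hfa]
    · rintro _ ⟨a, ha, rfl⟩ _ ⟨b, hb, rfl⟩ (hab : p (k • a) = p (k • b))
      rw [map_smul, map_smul, smul_left_cancel_iff] at hab
      exact congrArg (k • ·) (hinj ha hb hab)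
    · intro x (hx : f x = k • y)
      obtain ⟨a, ha, hpa⟩ := hsurj (a := k⁻¹ • x) (by
        rw [Set.mem_preimage, map_smul, hx, inv_smul_smul]; rfl)
      exact ⟨k • a, Set.smul_mem_smul_set ha, by rw [map_smul, hpa, smul_inv_smul]⟩

open scoped Pointwise in
theorem exists_isExponentialDiagram {X Y A : FinGSet G} (f : X →[G] Y) (p : A →[G] X) :
    ∃ (E P : FinGSet G) (e : E →[G] A) (f' : E →[G] P) (q : P →[G] Y),
      IsExponentialDiagram f p e f' q := by
  let E : SubMulAction G (A.carrier × sections f p) :=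
    { carrier := {t | t.1 ∈ t.2.1.2}
      smul_mem' := fun k t (ht : t.1 ∈ t.2.1.2) => Set.smul_mem_smul_set ht }
  refine ⟨⟨E⟩, ⟨sections f p⟩, ⟨fun t => t.1.1, fun _ _ => rfl⟩, ⟨fun t => t.1.2, fun _ _ => rfl⟩,
    ⟨fun w => w.1.1, fun _ _ => rfl⟩, ⟨fun t => t.1.2.2.mapsTo t.2, ?_⟩, ?_⟩
  · intro x w hxw
    obtain ⟨a, ha, rfl⟩ := w.2.surjOn hxw
    refine ⟨⟨(a, w), ha⟩, ⟨rfl, rfl⟩, ?_⟩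
    rintro ⟨⟨b, w'⟩, hb⟩ ⟨hpb, rfl⟩
    exact Subtype.ext (Prod.ext (w'.2.injOn hb ha hpb) rfl)
  · intro y s hs
    refine ⟨⟨(y, Set.range s), bijOn_range_section hs⟩, ⟨rfl, ?_⟩, ?_⟩
    · rintro ⟨⟨a, _⟩, ha⟩ rfl h
      obtain ⟨x, hx⟩ : ∃ x, s x = a := ha
      have hpa : ⟨p a, h⟩ = x := Subtype.ext (hx ▸ hs x)
      exact hx.symm.trans (congrArg s hpa.symm)
    · rintro ⟨⟨_, r⟩, hr⟩ ⟨rfl, h⟩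
      refine Subtype.ext (Prod.ext rfl (eq_range_section hr fun a ha => ?_))
      exact h ⟨(a, ⟨(_, r), hr⟩), ha⟩ rfl (hr.mapsTo ha)

theorem IsExponentialDiagram.surjective {X Y A E P : Type u} {f : X → Y} {p : A → X} {e : E → A}
    {f' : E → P} {q : P → Y} (h : IsExponentialDiagram f p e f' q) (hf : Function.Surjective f) :
    Function.Surjective f' :=
  IsPullbackSquare.surjective h.1 hf

theorem isExponentialDiagram_ofIsEmpty {X Y : FinGSet G} {f : X →[G] Y}
    (hf : Function.Surjective f) :
    IsExponentialDiagram f (ofIsEmpty (empty G) X) (MulActionHom.id G : empty G →[G] empty G)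
      (MulActionHom.id G : empty G →[G] empty G) (ofIsEmpty (empty G) Y) := by
  refine ⟨⟨fun t => isEmptyElim t, fun _ z => isEmptyElim z⟩, fun y s _ => ?_⟩
  obtain ⟨x, hx⟩ := hf y
  exact isEmptyElim (s ⟨x, hx⟩)

theorem isExponentialDiagram_fold {A X : FinGSet G} (p : A →[G] X) :
    IsExponentialDiagram (desc (MulActionHom.id G) (MulActionHom.id G) : sum X X →[G] X)
      (sumMap p (MulActionHom.id G : X →[G] X)) (sumMap (MulActionHom.id G : A →[G] A) p)
      (desc (MulActionHom.id G) (MulActionHom.id G) : sum A A →[G] A) p := by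
  refine ⟨⟨?_, ?_⟩, fun y s hs => ?_⟩
  · rintro (a | a) <;> rfl
  · rintro (x | x) a (rfl : x = p a)
    · refine ⟨Sum.inl a, ⟨rfl, rfl⟩, ?_⟩
      rintro (b | b) ⟨h, rfl⟩
      · rfl
      · exact absurd h Sum.inr_ne_inl
    · refine ⟨Sum.inr a, ⟨rfl, rfl⟩, ?_⟩
      rintro (b | b) ⟨h, rfl⟩
      · exact absurd h Sum.inl_ne_inr
      · rfl
  · have left : ∃ a : A, s ⟨Sum.inl y, rfl⟩ = Sum.inl a ∧ p a = y := by
      have hl := hs ⟨Sum.inl y, rfl⟩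
      rcases hsl : s ⟨Sum.inl y, rfl⟩ with a | x <;> rw [hsl] at hl
      · exact ⟨a, rfl, Sum.inl_injective hl⟩
      · exact absurd hl Sum.inr_ne_inl
    have right : s ⟨Sum.inr y, rfl⟩ = Sum.inr y := by
      have hr := hs ⟨Sum.inr y, rfl⟩
      rcases hsr : s ⟨Sum.inr y, rfl⟩ with b | x <;> rw [hsr] at hr
      · exact absurd hr Sum.inl_ne_inr
      · exact congrArg Sum.inr (Sum.inr_injective hr)
    obtain ⟨a, hsa, rfl⟩ := left
    refine ⟨a, ⟨rfl, ?_⟩, fun b ⟨hb, h⟩ => ?_⟩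
    · rintro (_ | _) rfl _
      exacts [hsa.symm, right.symm]
    · have hsb : s ⟨Sum.inl (p b), hb⟩ = Sum.inl a :=
        (congrArg s (Subtype.ext (congrArg Sum.inl hb))).trans hsa
      exact Sum.inl_injective ((h (Sum.inl b) rfl hb).trans hsb)

theorem exists_compl {X Y : FinGSet G} {i : X →[G] Y} (hi : Function.Injective i) :
    ∃ (Z : FinGSet G) (j : Z →[G] Y), Function.Bijective (Sum.elim i j) := by
  let S : SubMulAction G Y.carrier :=
    { carrier := (Set.range i)ᶜ
      smul_mem' := by
        rintro k y hy ⟨x, hx⟩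
        exact hy ⟨k⁻¹ • x, by rw [map_smul, hx, inv_smul_smul]⟩ }
  refine ⟨⟨S⟩, S.inclusion, hi.sumElim S.inclusion_injective fun x y hxy => y.2 ⟨x, hxy⟩,
    fun y => ?_⟩
  by_cases hy : y ∈ Set.range i
  · obtain ⟨x, rfl⟩ := hy
    exact ⟨Sum.inl x, rfl⟩
  · exact ⟨Sum.inr ⟨y, hy⟩, rfl⟩

theorem exists_image_factorization {X Y : FinGSet G} (f : X →[G] Y) :
    ∃ (Z : FinGSet G) (s : X →[G] Z) (i : Z →[G] Y),
      Function.Surjective s ∧ Function.Injective i ∧ i.comp s = f := by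
  let S : SubMulAction G Y.carrier :=
    { carrier := Set.range f
      smul_mem' := by
        rintro k _ ⟨x, rfl⟩
        exact ⟨k • x, map_smul f k x⟩ }
  exact ⟨⟨S⟩, ⟨Set.rangeFactorization f, fun k x => Subtype.ext (map_smul f k x)⟩, S.inclusion,
    Set.rangeFactorization_surjective, S.inclusion_injective, rfl⟩

/-! ## Transitive and induced `G`-sets -/

theorem surjective_of_isPretransitive {X Y : FinGSet G} [Nonempty X]
    [MulAction.IsPretransitive G Y] (f : X →[G] Y) : Function.Surjective f := fun y => by
  obtain ⟨x⟩ := ‹Nonempty X›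
  obtain ⟨g, rfl⟩ := MulAction.exists_smul_eq G (f x) y
  exact ⟨g • x, map_smul f g x⟩

theorem hom_ext_of_isPretransitive {X Y : FinGSet G} [MulAction.IsPretransitive G X]
    {f f' : X →[G] Y} (x : X) (h : f x = f' x) : f = f' := by
  ext x'
  obtain ⟨g, rfl⟩ := MulAction.exists_smul_eq G x x'
  rw [map_smul, map_smul, h]

theorem exists_hom_of_stabilizer_le {X Y : FinGSet G} [MulAction.IsPretransitive G X] {x : X}
    {y : Y} (h : MulAction.stabilizer G x ≤ MulAction.stabilizer G y) :
    ∃ f : X →[G] Y, f x = y := by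
  choose c hc using MulAction.exists_smul_eq G x
  have c_smul : ∀ g : G, c (g • x) • y = g • y := fun g => by
    have hmem : g⁻¹ * c (g • x) ∈ MulAction.stabilizer G x := by
      rw [MulAction.mem_stabilizer_iff, mul_smul, hc, inv_smul_smul]
    have hy := h hmem
    rwa [MulAction.mem_stabilizer_iff, mul_smul, inv_smul_eq_iff] at hy
  refine ⟨⟨fun x' => c x' • y, fun k x' => ?_⟩, ?_⟩
  · obtain ⟨g, rfl⟩ := MulAction.exists_smul_eq G x x'
    rw [c_smul, id, smul_smul, c_smul, smul_smul]
  · change c x • y = y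
    simpa only [one_smul] using c_smul 1

/-- The orbit of a point. -/
def orbit {X : FinGSet G} (x : X) : FinGSet G where
  carrier := MulAction.orbit G x

/-- The inclusion of an orbit. -/
def orbitIncl {X : FinGSet G} (x : X) : orbit x →[G] X where
  toFun := Subtype.val
  map_smul' _ _ := rfl

theorem orbitIncl_injective {X : FinGSet G} (x : X) : Function.Injective (orbitIncl x) :=
  Subtype.val_injective

/-- A point as a point of its orbit. -/
def orbitBase {X : FinGSet G} (x : X) : orbit x := ⟨x, MulAction.mem_orbit_self x⟩

instance {X : FinGSet G} (x : X) : Nonempty (orbit x) := ⟨orbitBase x⟩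

instance {X : FinGSet G} (x : X) : MulAction.IsPretransitive G (orbit x) :=
  inferInstanceAs (MulAction.IsPretransitive G (MulAction.orbit G x))

variable [Finite G] {H : Subgroup G}

instance {Y : FinGSet H} [Nonempty Y] : Nonempty (ind H Y) :=
  ‹Nonempty Y›.map (indMk 1)

theorem coe_smul_indMk_one {Y : FinGSet H} (h : H) (y : Y) :
    (h : G) • (indMk 1 y : ind H Y) = indMk 1 (h • y) := by
  rw [smul_indMk]
  exact indMk_eq.2 ⟨h, by simp, rfl⟩

theorem smul_indMk_one {Y : FinGSet H} (g : G) (y : Y) :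
    g • (indMk 1 y : ind H Y) = indMk g y := by
  rw [smul_indMk, mul_one]

instance {Y : FinGSet H} [MulAction.IsPretransitive H Y] :
    MulAction.IsPretransitive G (ind H Y) where
  exists_smul_eq a b := by
    obtain ⟨g, y, rfl⟩ := indMk_surj a
    obtain ⟨g', y', rfl⟩ := indMk_surj b
    obtain ⟨h, rfl⟩ := MulAction.exists_smul_eq H y y'
    refine ⟨g' * h * g⁻¹, ?_⟩
    rw [← smul_indMk_one g y, smul_smul, inv_mul_cancel_right, mul_smul, coe_smul_indMk_one,
      smul_indMk_one]

theorem stabilizer_le_of_ind [H.Normal] {Y : FinGSet H} (a : ind H Y) :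
    MulAction.stabilizer G a ≤ H := by
  obtain ⟨g, y, rfl⟩ := indMk_surj a
  intro k hk
  obtain ⟨h, hkg, -⟩ := indMk_eq.1 hk
  rw [← eq_mul_inv_iff_mul_eq] at hkg
  exact hkg ▸ ‹H.Normal›.conj_mem h h.2 g

theorem stabilizer_le_of_hom_ind [H.Normal] {A : FinGSet G} {Y : FinGSet H} (w : A →[G] ind H Y)
    (a : A) : MulAction.stabilizer G a ≤ H := fun k hk =>
  stabilizer_le_of_ind (w a) (show k • w a = w a by rw [← map_smul, show k • a = a from hk])

variable (H)

theorem indCounit_surjective (X : FinGSet G) : Function.Surjective (indCounit H X) := fun x =>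
  ⟨indMk (Y := X.res H) 1 x, one_smul G x⟩

theorem indCounit_comp_indMap_indInclusion (Y : FinGSet H) :
    (indCounit H (ind H Y)).comp (indMap H (NakaokaSpec.indInclusion H Y)) =
      MulActionHom.id G := by
  ext a
  obtain ⟨g, y, rfl⟩ := indMk_surj a
  exact smul_indMk_one g y

/-- The `H`-orbit of a point of a `G`-set. -/
def resOrbit {Z : FinGSet G} (z : Z) : FinGSet H := orbit (X := Z.res H) z

instance {Z : FinGSet G} (z : Z) : Nonempty (resOrbit H z) := ⟨orbitBase (X := Z.res H) z⟩

instance {Z : FinGSet G} (z : Z) : MulAction.IsPretransitive H (resOrbit H z) :=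
  inferInstanceAs (MulAction.IsPretransitive H (MulAction.orbit H (show Z.res H from z)))

/-- The action map `G ×_H Hz → Z`, `[g, z'] ↦ g z'`. -/
def indOrbit {Z : FinGSet G} (z : Z) : ind H (resOrbit H z) →[G] Z :=
  (indCounit H Z).comp (indMap H (orbitIncl (X := Z.res H) z))

theorem exists_indOrbit_comp_eq {C Z : FinGSet G} [MulAction.IsPretransitive G C] (f : C →[G] Z)
    {c : C} (hc : MulAction.stabilizer G c ≤ H) :
    ∃ s : C →[G] ind H (resOrbit H (f c)), (indOrbit H (f c)).comp s = f := by
  let base : resOrbit H (f c) := orbitBase (X := Z.res H) (f c)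
  have stabilizer_le : MulAction.stabilizer G c ≤
      MulAction.stabilizer G (indMk 1 base : ind H (resOrbit H (f c))) := by
    intro k hk
    have hfix : k • f c = f c := by rw [← map_smul, show k • c = c from hk]
    have hbase : (⟨k, hc hk⟩ : H) • base = base := Subtype.ext hfix
    exact (coe_smul_indMk_one ⟨k, hc hk⟩ base).trans (congrArg (indMk 1) hbase)
  obtain ⟨s, hs⟩ := exists_hom_of_stabilizer_le stabilizer_le
  refine ⟨s, hom_ext_of_isPretransitive c ?_⟩
  change indOrbit H (f c) (s c) = f c
  rw [hs]
  exact one_smul G (f c)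

end FinGSet

/-! ## Arithmetic in a Tambara functor -/

namespace TambaraFunctor

variable {G : Type u} [Group G] (R : TambaraFunctor.{u, v} G)

theorem ext_of_coproduct {X Y Z : FinGSet G} {i : X →[G] Z} {j : Y →[G] Z}
    (h : Function.Bijective (Sum.elim i j)) {a b : R.obj Z} (hi : R.res i a = R.res i b)
    (hj : R.res j a = R.res j b) : a = b :=
  (R.bijective_res_of_coproduct i j h).1 (Prod.ext hi hj)

theorem exists_res_eq {X Y : FinGSet G} (a : R.obj X) (b : R.obj Y) :
    ∃ c : R.obj (sum X Y), R.res (inl X Y) c = a ∧ R.res (inr X Y) c = b := by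
  obtain ⟨c, hc⟩ := (R.bijective_res_of_coproduct _ _ (bijective_elim_inl_inr X Y)).2 (a, b)
  exact ⟨c, congrArg Prod.fst hc, congrArg Prod.snd hc⟩

instance : Subsingleton (R.obj (FinGSet.empty G)) :=
  R.subsingleton_of_isEmpty _ inferInstance

theorem res_tr_of_injective {X Y : FinGSet G} {i : X →[G] Y} (hi : Function.Injective i)
    (a : R.obj X) : R.res i (R.tr i a) = a := by
  rw [R.res_tr _ _ _ _ (isPullbackSquare_of_injective hi), R.res_id, R.tr_id]

theorem res_nm_of_injective {X Y : FinGSet G} {i : X →[G] Y} (hi : Function.Injective i)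
    (a : R.obj X) : R.res i (R.nm i a) = a := by
  rw [R.res_nm _ _ _ _ (isPullbackSquare_of_injective hi), R.res_id, R.nm_id]

theorem res_tr_of_disjoint {X Y Z : FinGSet G} {f : X →[G] Y} {g : Z →[G] Y}
    (h : ∀ x z, f x ≠ g z) (a : R.obj X) : R.res g (R.tr f a) = 0 := by
  rw [R.res_tr _ _ _ _ (isPullbackSquare_of_disjoint h), Subsingleton.elim (R.res _ a) 0, map_zero]

theorem res_nm_of_disjoint {X Y Z : FinGSet G} {f : X →[G] Y} {g : Z →[G] Y}
    (h : ∀ x z, f x ≠ g z) (a : R.obj X) : R.res g (R.nm f a) = 1 := by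
  rw [R.res_nm _ _ _ _ (isPullbackSquare_of_disjoint h), Subsingleton.elim (R.res _ a) 1, map_one]

section Coproduct

variable {R} {X Y Z : FinGSet G} {i : X →[G] Z} {j : Y →[G] Z}
  (h : Function.Bijective (Sum.elim i j))

include h

theorem eq_tr_res_add_tr_res (a : R.obj Z) :
    a = R.tr i (R.res i a) + R.tr j (R.res j a) := by
  obtain ⟨hi, hj, hij⟩ := Sum.elim_injective.1 h.1
  refine R.ext_of_coproduct h ?_ ?_
  · rw [map_add, R.res_tr_of_injective hi, R.res_tr_of_disjoint fun y x => (hij x y).symm, add_zero]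
  · rw [map_add, R.res_tr_of_injective hj, R.res_tr_of_disjoint hij, zero_add]

theorem eq_nm_res_mul_nm_res (a : R.obj Z) :
    a = R.nm i (R.res i a) * R.nm j (R.res j a) := by
  obtain ⟨hi, hj, hij⟩ := Sum.elim_injective.1 h.1
  refine R.ext_of_coproduct h ?_ ?_
  · rw [map_mul, R.res_nm_of_injective hi, R.res_nm_of_disjoint fun y x => (hij x y).symm, mul_one]
  · rw [map_mul, R.res_nm_of_injective hj, R.res_nm_of_disjoint hij, one_mul]

theorem tr_eq_add_of_coproduct {W : FinGSet G} (f : Z →[G] W) (a : R.obj Z) :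
    R.tr f a = R.tr (f.comp i) (R.res i a) + R.tr (f.comp j) (R.res j a) := by
  rw [R.tr_comp, R.tr_comp, ← map_add, ← eq_tr_res_add_tr_res h]

theorem nm_eq_mul_of_coproduct {W : FinGSet G} (f : Z →[G] W) (a : R.obj Z) :
    R.nm f a = R.nm (f.comp i) (R.res i a) * R.nm (f.comp j) (R.res j a) := by
  rw [R.nm_comp, R.nm_comp, ← map_mul, ← eq_nm_res_mul_nm_res h]

end Coproduct

theorem nm_zero_of_surjective {X Y : FinGSet G} {f : X →[G] Y} (hf : Function.Surjective f) :
    R.nm f 0 = 0 := by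
  have h := R.nm_tr _ _ _ _ _ (isExponentialDiagram_ofIsEmpty hf) 0
  rwa [map_zero (R.tr _), Subsingleton.elim (R.nm (MulActionHom.id G) _) 0,
    map_zero (R.tr _)] at h

/-- Frobenius reciprocity, an instance of the distributive law because multiplication is the norm
along the fold map. -/
theorem tr_mul {A X : FinGSet G} (p : A →[G] X) (a : R.obj A) (b : R.obj X) :
    R.tr p a * b = R.tr p (a * R.res p b) := by
  obtain ⟨c, rfl, rfl⟩ := R.exists_res_eq a b
  have h := R.nm_tr _ _ _ _ _ (isExponentialDiagram_fold p) c
  rw [nm_eq_mul_of_coproduct (bijective_elim_inl_inr X X),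
    nm_eq_mul_of_coproduct (bijective_elim_inl_inr A A), desc_comp_inl, desc_comp_inr,
    desc_comp_inl, desc_comp_inr, R.nm_id, R.nm_id, R.nm_id, R.nm_id,
    R.res_tr _ _ _ _ (isPullbackSquare_inl p (MulActionHom.id G)),
    R.res_tr _ _ _ _ (isPullbackSquare_inr p (MulActionHom.id G)), R.tr_id,
    ← R.res_comp, ← R.res_comp] at h
  rw [h, ← R.res_comp]
  congr 2

end TambaraFunctor

/-! ## Generation of Tambara ideals -/

namespace GreenIdeal

variable {G : Type u} [Group G] {R : TambaraFunctor.{u, v} G}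

theorem mem_of_res_mem_of_coproduct (I : GreenIdeal R) {X Y Z : FinGSet G} {i : X →[G] Z}
    {j : Y →[G] Z} (h : Function.Bijective (Sum.elim i j)) {a : R.obj Z}
    (hi : R.res i a ∈ I.carrier X) (hj : R.res j a ∈ I.carrier Y) : a ∈ I.carrier Z := by
  rw [TambaraFunctor.eq_tr_res_add_tr_res h a]
  exact add_mem (I.tr_mem i hi) (I.tr_mem j hj)

theorem mem_of_forall_isPretransitive (I : GreenIdeal R) {Z : FinGSet G} {x : R.obj Z}
    (h : ∀ (T : FinGSet G) (f : T →[G] Z) [MulAction.IsPretransitive G T] [Nonempty T],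
      R.res f x ∈ I.carrier T) : x ∈ I.carrier Z := by
  induction hn : Nat.card Z using Nat.strong_induction_on generalizing Z with
  | _ n ih =>
    rcases isEmpty_or_nonempty Z with hZ | ⟨⟨z⟩⟩
    · have := R.subsingleton_of_isEmpty Z hZ
      rw [Subsingleton.elim x 0]
      exact zero_mem _
    · obtain ⟨W, j, hj⟩ := exists_compl (orbitIncl_injective z)
      have card_lt : Nat.card W < n := by
        rw [← hn, ← Nat.card_eq_of_bijective _ hj, Nat.card_sum]
        exact Nat.lt_add_of_pos_left Nat.card_pos
      refine I.mem_of_res_mem_of_coproduct hj (h _ _) (ih _ card_lt (fun T f _ _ => ?_) rfl)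
      rw [← R.res_comp]
      exact h T _

theorem isTambara_of_surjective {I : GreenIdeal R}
    (h : ∀ ⦃X Y : FinGSet G⦄ (f : X →[G] Y), Function.Surjective f → ∀ a ∈ I.carrier X,
      R.nm f a ∈ I.carrier Y) : I.IsTambara := by
  intro X Y f a ha
  obtain ⟨Z, s, i, hs, hi, rfl⟩ := exists_image_factorization f
  obtain ⟨W, j, hj⟩ := exists_compl hi
  obtain ⟨-, -, hij⟩ := Sum.elim_injective.1 hj.1
  rw [R.nm_comp, R.nm_comp, R.nm_zero_of_surjective hs]
  refine I.mem_of_res_mem_of_coproduct hj ?_ ?_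
  · rw [map_sub, R.res_nm_of_injective hi, R.res_nm_of_injective hi, sub_zero]
    exact h s hs a ha
  · rw [map_sub, R.res_nm_of_disjoint hij, R.res_nm_of_disjoint hij, sub_self]
    exact zero_mem _

theorem IsTambara.nm_mem {I : GreenIdeal R} (hI : I.IsTambara) {X Y : FinGSet G} {f : X →[G] Y}
    (hf : Function.Surjective f) {a : R.obj X} (ha : a ∈ I.carrier X) :
    R.nm f a ∈ I.carrier Y := by
  simpa only [R.nm_zero_of_surjective hf, sub_zero] using hI f a ha

/-- The Tambara ideal generated by the levels of `I` at the `G`-sets that map to `W`. Its elements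
are the transfers of multiples of norms of elements of these levels. -/
def normSpan (I : GreenIdeal R) (W : FinGSet G) : GreenIdeal R where
  carrier X :=
    { carrier := {x | ∃ (Z A : FinGSet G) (u : Z →[G] X) (v : A →[G] Z) (_ : A →[G] W)
        (c : R.obj Z), ∃ a ∈ I.carrier A, Function.Surjective v ∧ x = R.tr u (c * R.nm v a)}
      zero_mem' := by
        refine ⟨FinGSet.empty G, FinGSet.empty G, ofIsEmpty _ _, MulActionHom.id G, ofIsEmpty _ _,
          0, 0, zero_mem _, Function.surjective_id, ?_⟩
        rw [zero_mul, map_zero]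
      add_mem' := by
        rintro _ _ ⟨Z, A, u, v, w, c, a, ha, hv, rfl⟩ ⟨Z', A', u', v', w', c', a', ha', hv', rfl⟩
        obtain ⟨d, rfl, rfl⟩ := R.exists_res_eq c c'
        obtain ⟨b, rfl, rfl⟩ := R.exists_res_eq a a'
        refine ⟨sum Z Z', sum A A', desc u u', sumMap v v', desc w w', d, b,
          I.mem_of_res_mem_of_coproduct (bijective_elim_inl_inr A A') ha ha', hv.sumMap hv', ?_⟩
        rw [TambaraFunctor.tr_eq_add_of_coproduct (bijective_elim_inl_inr Z Z'),
          map_mul (R.res _), map_mul (R.res _), R.res_nm _ _ _ _ (isPullbackSquare_inl v v'),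
          R.res_nm _ _ _ _ (isPullbackSquare_inr v v'), desc_comp_inl, desc_comp_inr]
      smul_mem' := by
        rintro r _ ⟨Z, A, u, v, w, c, a, ha, hv, rfl⟩
        refine ⟨Z, A, u, v, w, R.res u r * c, a, ha, hv, ?_⟩
        rw [smul_eq_mul, mul_comm, R.tr_mul, mul_comm, mul_assoc] }
  res_mem := by
    rintro X X' f _ ⟨Z, A, u, v, w, c, a, ha, hv, rfl⟩
    obtain ⟨P, g, u', hP⟩ := exists_isPullbackSquare u f
    obtain ⟨Q, k, v', hQ⟩ := exists_isPullbackSquare v g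
    refine ⟨P, Q, u', v', w.comp k, R.res g c, R.res k a, I.res_mem k ha, hQ.surjective hv, ?_⟩
    rw [R.res_tr _ _ _ _ hP, map_mul, R.res_nm _ _ _ _ hQ]
  tr_mem := by
    rintro X X' f _ ⟨Z, A, u, v, w, c, a, ha, hv, rfl⟩
    exact ⟨Z, A, f.comp u, v, w, c, a, ha, hv, (R.tr_comp _ _ _).symm⟩

theorem normSpan_isTambara (I : GreenIdeal R) (W : FinGSet G) : (I.normSpan W).IsTambara := by
  refine isTambara_of_surjective ?_
  rintro X X' f hf _ ⟨Z, A, u, v, w, c, a, ha, hv, rfl⟩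
  obtain ⟨E, P, e, f', q, hE⟩ := exists_isExponentialDiagram f u
  obtain ⟨Q, k, v', hQ⟩ := exists_isPullbackSquare v e
  refine ⟨P, Q, q, f'.comp v', w.comp k, R.nm f' (R.res e c), R.res k a, I.res_mem k ha,
    (hE.surjective hf).comp (hQ.surjective hv), ?_⟩
  rw [R.nm_tr _ _ _ _ _ hE, map_mul, map_mul, R.res_nm _ _ _ _ hQ, R.nm_comp]

theorem mem_normSpan {I : GreenIdeal R} {W A : FinGSet G} (w : A →[G] W) {a : R.obj A}
    (ha : a ∈ I.carrier A) : a ∈ (I.normSpan W).carrier A :=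
  ⟨A, A, MulActionHom.id G, MulActionHom.id G, w, 1, a, ha, Function.surjective_id, by
    rw [one_mul, R.nm_id, R.tr_id]⟩

theorem normSpan_le_iff {I P : GreenIdeal R} {W : FinGSet G} (hP : P.IsTambara) :
    I.normSpan W ≤ P ↔ ∀ (A : FinGSet G) (_ : A →[G] W), I.carrier A ≤ P.carrier A := by
  refine ⟨fun h A w a ha => h A (mem_normSpan w ha), ?_⟩
  rintro h X _ ⟨Z, A, u, v, w, c, a, ha, hv, rfl⟩
  exact P.tr_mem u (Ideal.mul_mem_left _ c (hP.nm_mem hv (h A w ha)))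

theorem mul_mem_of_mem_normSpan {I P : GreenIdeal R} {W X : FinGSet G} {x y : R.obj X}
    (hx : x ∈ (I.normSpan W).carrier X)
    (h : ∀ (Z A : FinGSet G) (u : Z →[G] X) (v : A →[G] Z) (_ : A →[G] W),
      Function.Surjective v → ∀ a ∈ I.carrier A, R.nm v a * R.res u y ∈ P.carrier Z) :
    x * y ∈ P.carrier X := by
  obtain ⟨Z, A, u, v, w, c, a, ha, hv, rfl⟩ := hx
  rw [R.tr_mul, mul_assoc]
  exact P.tr_mem u (Ideal.mul_mem_left _ c (h Z A u v w hv a ha))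

theorem normSpan_mul_normSpan_le {I J P : GreenIdeal R} {W W' : FinGSet G} (hP : P.IsTambara)
    (h : ∀ (Z A B : FinGSet G) [MulAction.IsPretransitive G Z] [Nonempty Z] (v : A →[G] Z)
      (v' : B →[G] Z) (_ : A →[G] W) (_ : B →[G] W'), Function.Surjective v →
      Function.Surjective v' → ∀ a ∈ I.carrier A, ∀ b ∈ J.carrier B,
        R.nm v a * R.nm v' b ∈ P.carrier Z) :
    I.normSpan W * J.normSpan W' ≤ P := by
  rw [mul_le_iff hP]
  intro X x hx y hy
  refine mul_mem_of_mem_normSpan hx fun Z A u v w hv a ha => ?_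
  rw [mul_comm]
  refine mul_mem_of_mem_normSpan ((J.normSpan W').res_mem u hy) fun Z' B u' v' w' hv' b hb => ?_
  refine P.mem_of_forall_isPretransitive fun T f _ _ => ?_
  obtain ⟨A', k, p, hA'⟩ := exists_isPullbackSquare v (u'.comp f)
  obtain ⟨B', l, q, hB'⟩ := exists_isPullbackSquare v' f
  rw [mul_comm, map_mul, ← R.res_comp, R.res_nm _ _ _ _ hA', R.res_nm _ _ _ _ hB']
  exact h T A' B' p q (w.comp k) (w'.comp l) (hA'.surjective hv) (hB'.surjective hv') _
    (I.res_mem k ha) _ (J.res_mem l hb)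

end GreenIdeal

/-! ## Idleness relative to a subgroup -/

/-- `R` is idle relative to `H` if restriction along an arbitrary `G`-map `G ×_H T → G ×_H Y`, with
`T` transitive, agrees with restriction along some induced map. This is the only consequence of
idleness that the comparison of `R` with `Res_H^G R` depends on. -/
def TambaraFunctor.IsIdleRelative {G : Type u} [Group G] [Finite G] (R : TambaraFunctor.{u, v} G)
    (H : Subgroup G) : Prop :=
  ∀ ⦃T Y : FinGSet H⦄ [MulAction.IsPretransitive H T] [Nonempty T] (f : ind H T →[G] ind H Y),
    ∃ θ : T →[H] Y, R.res f = R.res (indMap H θ)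

section

variable {G : Type u} [Group G]

theorem stabilizer_smul_eq_of_normal {X : Type*} [MulAction G X] (g : G) (x : X)
    [(MulAction.stabilizer G x).Normal] :
    MulAction.stabilizer G (g • x) = MulAction.stabilizer G x :=
  (MulAction.stabilizer_smul_eq_stabilizer_map_conj g x).trans (Subgroup.Normal.map_conj_eq _ g)

theorem FinGSet.exists_bijective_hom_of_normal {X : FinGSet G} [MulAction.IsPretransitive G X]
    (x : X) [(MulAction.stabilizer G x).Normal] (g : G) :
    ∃ φ : X →[G] X, Function.Bijective φ ∧ φ x = g • x := by
  have : Nonempty X := ⟨x⟩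
  obtain ⟨φ, hφ⟩ := exists_hom_of_stabilizer_le (stabilizer_smul_eq_of_normal g x).ge
  exact ⟨φ, Function.Surjective.bijective_of_finite (surjective_of_isPretransitive φ), hφ⟩

variable [Finite G] {H : Subgroup G} {R : TambaraFunctor.{u, v} G}

theorem TambaraFunctor.IsIdle.isIdleRelative (hH : ∀ K ≤ H, K.Normal) (hR : R.IsIdle) :
    R.IsIdleRelative H := by
  intro T Y _ ⟨t⟩ f
  have := hH H le_rfl
  have stabilizer_normal {W : FinGSet H} (w : ind H W) : (MulAction.stabilizer G w).Normal :=
    hH _ (stabilizer_le_of_ind w)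
  obtain ⟨g, y, hgy⟩ := indMk_surj (f (indMk 1 t))
  rw [← smul_indMk_one g y] at hgy
  have stabilizer_le : MulAction.stabilizer H t ≤ MulAction.stabilizer H y := by
    intro h (hh : h • t = t)
    have mem_stabilizer : (h : G) ∈ MulAction.stabilizer G (g • (indMk 1 y : ind H Y)) := by
      rw [MulAction.mem_stabilizer_iff, ← hgy, ← map_smul, coe_smul_indMk_one, hh]
    rwa [stabilizer_smul_eq_of_normal, MulAction.mem_stabilizer_iff,
      coe_smul_indMk_one, indMk_inj] at mem_stabilizer
  obtain ⟨θ, rfl⟩ := exists_hom_of_stabilizer_le stabilizer_le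
  obtain ⟨φ, hφ, hφt⟩ := exists_bijective_hom_of_normal (indMk 1 t : ind H T) g
  have f_eq : f = (indMap H θ).comp φ := by
    refine hom_ext_of_isPretransitive (indMk 1 t) ?_
    rw [hgy, MulActionHom.comp_apply, hφt, map_smul, indMap_indMk]
  refine ⟨θ, RingHom.ext fun a => ?_⟩
  rw [f_eq, R.res_comp, hR _ inferInstance φ hφ]

end

/-! ## Contraction and extension of ideals -/

namespace GreenIdeal

variable {G : Type u} [Group G] [Finite G] {H : Subgroup G} {R : TambaraFunctor.{u, v} G}

/-- The contraction of `CoInd_H^G I` along the unit `R → CoInd_H^G Res_H^G R`; on prime ideals this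
is the stratum map. -/
abbrev contract (I : GreenIdeal (R.restrict H)) : GreenIdeal R :=
  I.coinduce.comap (R.coindUnit H)

theorem mem_contract {I : GreenIdeal (R.restrict H)} {X : FinGSet G} {a : R.obj X} :
    a ∈ I.contract.carrier X ↔ R.res (indCounit H X) a ∈ I.carrier (X.res H) :=
  Iff.rfl

theorem IsTambara.contract {I : GreenIdeal (R.restrict H)} (hI : I.IsTambara) :
    I.contract.IsTambara :=
  hI.coinduce.comap _

theorem restrict_mono {I J : GreenIdeal R} (h : I ≤ J) : I.restrict H ≤ J.restrict H :=
  fun Y => h (ind H Y)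

theorem restrict_contract_le (I : GreenIdeal (R.restrict H)) : I.contract.restrict H ≤ I := by
  intro Y (a : R.obj (ind H Y)) ha
  have res_mem := I.res_mem (NakaokaSpec.indInclusion H Y) (mem_contract.1 ha)
  have res_eq : R.res (indMap H (NakaokaSpec.indInclusion H Y))
      (R.res (indCounit H (ind H Y)) a) = a := by
    rw [← R.res_comp, indCounit_comp_indMap_indInclusion, R.res_id]
  exact res_eq ▸ res_mem

theorem restrict_le_iff_le_contract {I : GreenIdeal R} {J : GreenIdeal (R.restrict H)} :
    I.restrict H ≤ J ↔ I ≤ J.contract :=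
  ⟨fun h X _ ha => h (X.res H) (I.res_mem (indCounit H X) ha),
    fun h => (restrict_mono h).trans J.restrict_contract_le⟩

theorem restrict_contract (hR : R.IsIdleRelative H) (I : GreenIdeal (R.restrict H)) :
    I.contract.restrict H = I := by
  refine le_antisymm I.restrict_contract_le fun Y (a : R.obj (ind H Y)) ha => ?_
  refine mem_contract.2 (I.mem_of_forall_isPretransitive fun T f _ _ => ?_)
  obtain ⟨θ, hθ⟩ := hR ((indCounit H (ind H Y)).comp (indMap H f))
  have res_eq : R.res (indMap H f) (R.res (indCounit H (ind H Y)) a) = R.res (indMap H θ) a := by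
    rw [← R.res_comp, hθ]
  exact res_eq ▸ I.res_mem θ ha

/-- The Tambara ideal of `R` generated by the elements of `I.contract` over `G/H = G ×_H pt`. Unlike
`I.contract`, it is contained in a Tambara ideal `P` as soon as `I ≤ P.restrict H`. -/
def extend (I : GreenIdeal (R.restrict H)) : GreenIdeal R :=
  I.contract.normSpan (ind H (FinGSet.point H))

theorem extend_isTambara (I : GreenIdeal (R.restrict H)) : I.extend.IsTambara :=
  normSpan_isTambara _ _

theorem IsTambara.nm_eq_nm_indOrbit_mul [H.Normal] {K : GreenIdeal R} (hK : K.IsTambara)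
    {A Z : FinGSet G} {Y : FinGSet H} (v : A →[G] Z) (w : A →[G] ind H Y) {a : R.obj A}
    (ha : a ∈ K.carrier A) {a₀ : A} {z : Z} (hz : v a₀ = z) :
    ∃ x ∈ K.carrier (ind H (resOrbit H z)), ∃ r, R.nm v a = R.nm (indOrbit H z) x * r := by
  subst hz
  obtain ⟨W, j, hj⟩ := exists_compl (orbitIncl_injective a₀)
  obtain ⟨s, hs⟩ := exists_indOrbit_comp_eq H (v.comp (orbitIncl a₀))
    (stabilizer_le_of_hom_ind (w.comp (orbitIncl a₀)) (orbitBase a₀))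
  refine ⟨R.nm s (R.res (orbitIncl a₀) a),
    hK.nm_mem (surjective_of_isPretransitive s) (K.res_mem _ ha), R.nm (v.comp j) (R.res j a), ?_⟩
  rw [TambaraFunctor.nm_eq_mul_of_coproduct hj]
  exact congrArg (· * _) ((congrArg (R.nm · _) hs.symm).trans (R.nm_comp _ _ _))

theorem extend_le_iff [H.Normal] (hR : R.IsIdleRelative H) {I : GreenIdeal (R.restrict H)}
    {P : GreenIdeal R} (hP : P.IsTambara) : I.extend ≤ P ↔ I ≤ P.restrict H := by
  constructor
  · intro h Y a ha
    rw [← I.restrict_contract hR] at ha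
    exact h _ (mem_normSpan (indMap H (toPoint Y)) ha)
  · refine fun h => (normSpan_le_iff hP).2 fun A w a ha => ?_
    refine P.mem_of_forall_isPretransitive fun T f _ ⟨t⟩ => ?_
    obtain ⟨s, hs⟩ := exists_indOrbit_comp_eq H f (stabilizer_le_of_hom_ind (w.comp f) t)
    have res_mem : R.res (indOrbit H (f t)) a ∈ I.carrier (resOrbit H (f t)) :=
      I.restrict_contract_le _ (I.contract.res_mem _ ha)
    rw [← hs, R.res_comp]
    exact P.res_mem s (h _ res_mem)

theorem extend_mul_extend_le [H.Normal] {I J : GreenIdeal (R.restrict H)} {P : GreenIdeal R}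
    (hI : I.IsTambara) (hJ : J.IsTambara) (hP : P.IsTambara) (h : I * J ≤ P.restrict H) :
    I.extend * J.extend ≤ P := by
  refine normSpan_mul_normSpan_le hP fun Z A B _ ⟨z⟩ v v' w w' hv hv' a ha b hb => ?_
  obtain ⟨a₀, ha₀⟩ := hv z
  obtain ⟨b₀, hb₀⟩ := hv' z
  obtain ⟨x, hx, r, hr⟩ := hI.contract.nm_eq_nm_indOrbit_mul v w ha ha₀
  obtain ⟨y, hy, r', hr'⟩ := hJ.contract.nm_eq_nm_indOrbit_mul v' w' hb hb₀
  have mul_mem : x * y ∈ P.carrier (ind H (resOrbit H z)) :=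
    (mul_le_iff (hP.restrictIdeal H)).1 h _ x (I.restrict_contract_le _ hx) y
      (J.restrict_contract_le _ hy)
  rw [hr, hr', mul_mul_mul_comm, ← map_mul]
  exact Ideal.mul_mem_right _ _ (hP.nm_mem (surjective_of_isPretransitive _) mul_mem)

theorem IsPrime.restrict [H.Normal] (hR : R.IsIdleRelative H) {p : GreenIdeal R}
    (hp : p.IsPrime) : (p.restrict H).IsPrime where
  isTambara := hp.isTambara.restrictIdeal H
  ne_top := by
    obtain ⟨X, hX⟩ := hp.ne_top
    refine ⟨X.res H, fun h => hX ?_⟩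
    have one_mem : (1 : R.obj (ind H (X.res H))) ∈ p.carrier _ := (Ideal.eq_top_iff_one _).1 h
    rw [Ideal.eq_top_iff_one, ← map_one (R.nm (indCounit H X))]
    exact hp.isTambara.nm_mem (indCounit_surjective H X) one_mem
  le_or_le I J hI hJ h := by
    rw [← extend_le_iff hR hp.isTambara, ← extend_le_iff hR hp.isTambara]
    exact hp.le_or_le _ _ I.extend_isTambara J.extend_isTambara
      (extend_mul_extend_le hI hJ hp.isTambara h)

end GreenIdeal

/-! ## Continuity -/

namespace NakaokaSpec

theorem continuous_of_forall_exists_le_iff {G G' : Type u} [Group G] [Group G']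
    {R : TambaraFunctor.{u, v} G} {S : TambaraFunctor.{u, v} G'} {φ : NakaokaSpec R → NakaokaSpec S}
    (h : ∀ I : GreenIdeal S, I.IsTambara →
      ∃ J : GreenIdeal R, J.IsTambara ∧ ∀ p, J ≤ p.1 ↔ I ≤ (φ p).1) : Continuous φ := by
  refine continuous_generateFrom_iff.2 ?_
  rintro _ ⟨I, hI, rfl⟩
  obtain ⟨J, hJ, hJI⟩ := h I hI
  exact TopologicalSpace.isOpen_generateFrom_of_mem
    ⟨J, hJ, Set.ext fun p => not_congr (hJI p).symm⟩

variable {G : Type u} [Group G] [Finite G] (H : Subgroup G) (R : TambaraFunctor.{u, v} G)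

theorem continuous_stratumMap : Continuous (stratumMap H R) :=
  continuous_of_forall_exists_le_iff fun I hI =>
    ⟨I.restrict H, hI.restrictIdeal H, fun _ => GreenIdeal.restrict_le_iff_le_contract⟩

variable {H R} [H.Normal] (hR : R.IsIdleRelative H)

/-- The map `Spec(R) → Spec(Res_H^G R)`, `p ↦ Res_H^G p`. -/
def restrict (p : NakaokaSpec R) : NakaokaSpec (R.restrict H) :=
  ⟨p.1.restrict H, p.2.restrict hR⟩

theorem continuous_restrict : Continuous (restrict hR) :=
  continuous_of_forall_exists_le_iff fun I _ =>
    ⟨I.extend, I.extend_isTambara, fun p => GreenIdeal.extend_le_iff hR p.2.isTambara⟩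

theorem restrict_stratumMap (q : NakaokaSpec (R.restrict H)) :
    restrict hR (stratumMap H R q) = q :=
  Subtype.ext (q.1.restrict_contract hR)

end NakaokaSpec

theorem mainTheorem11_general {G : Type u} [Group G] [Finite G] (R : TambaraFunctor.{u, v} G)
    (H : Subgroup G) [H.Normal] (hR : R.IsIdleRelative H) :
    Monotone (fun I : GreenIdeal R => I.restrict H) ∧
    (∀ I : GreenIdeal R, I.IsTambara → (I.restrict H).IsTambara) ∧
    (∀ p : GreenIdeal R, p.IsPrime → (p.restrict H).IsPrime) ∧
    (∃ ρ : CategoryTheory.Retract (TopCat.of (NakaokaSpec (R.restrict H)))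
        (TopCat.of (NakaokaSpec R)),
      (∀ q : NakaokaSpec (R.restrict H), ρ.i.hom q = NakaokaSpec.stratumMap H R q) ∧
      (∀ p : NakaokaSpec R, (ρ.r.hom p : NakaokaSpec (R.restrict H)).1 = p.1.restrict H)) ∧
    Function.Injective (NakaokaSpec.stratumMap H R) := by
  refine ⟨fun _ _ => GreenIdeal.restrict_mono, fun _ hI => hI.restrictIdeal H,
    fun _ hp => hp.restrict hR, ⟨{
      i := TopCat.ofHom ⟨_, NakaokaSpec.continuous_stratumMap H R⟩
      r := TopCat.ofHom ⟨_, NakaokaSpec.continuous_restrict hR⟩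
      retract := ?_ }, fun _ => rfl, fun _ => rfl⟩, ?_⟩
  · ext q
    exact NakaokaSpec.restrict_stratumMap hR q
  · exact Function.LeftInverse.injective (NakaokaSpec.restrict_stratumMap hR)

theorem mainTheorem11 {G : Type u} [Group G] [Finite G] (hG : IsDedekindGroup G)
    (R : TambaraFunctor.{u, v} G) (hR : R.IsIdle) (H : Subgroup G) :
    Monotone (fun I : GreenIdeal R => I.restrict H) ∧
    (∀ I : GreenIdeal R, I.IsTambara → (I.restrict H).IsTambara) ∧
    (∀ p : GreenIdeal R, p.IsPrime → (p.restrict H).IsPrime) ∧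
    (∃ ρ : CategoryTheory.Retract (TopCat.of (NakaokaSpec (R.restrict H)))
        (TopCat.of (NakaokaSpec R)),
      (∀ q : NakaokaSpec (R.restrict H), ρ.i.hom q = NakaokaSpec.stratumMap H R q) ∧
      (∀ p : NakaokaSpec R, (ρ.r.hom p : NakaokaSpec (R.restrict H)).1 = p.1.restrict H)) ∧
    Function.Injective (NakaokaSpec.stratumMap H R) := by
  have := hG H
  exact mainTheorem11_general R H (hR.isIdleRelative fun K _ => hG K)
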